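/- In the Repeated Prophet Inequality with $2n$ items, an adversary fixes values $v_1\ge v_2\ge\dots\ge v_{2n}\ge 0$, not all zero, and nature draws a uniformly random permutation $\sigma$ of $\{1,\dots,2n\}$. In Phase 1 the items $\sigma(1),\dots,\sigma(n)$ arrive one by one; in Phase 2 the items $\sigma(n+1),\dots,\sigma(2n)$ arrive one by one. At each arrival the decision maker learns only the relative rank of the new item among all items revealed so far (in both phases); ties are broken by a fixed ranking of the items, consistent with the values, that is selected publicly before the process starts. She then irrevocably accepts or rejects the item. Accepting ends the current phase: its remaining items are never revealed. So at most one item is accepted in each phase; a phase without an accepted item yields $0$. An algorithm $\mathbf{ALG}=(\mathrm{ALG}_n)_{n\in\mathbb N}$ prescribes a (possibly randomized) decision rule of this kind for every $n$. In the values observed variant the rule may depend on the values $v_1,\dots,v_{2n}$, which are known in advance; in the value-oblivious variant it may not. Let $\mathrm{ALG}_n(v)$ be the sum of the values of the accepted items, and let $$\mathrm{perf}(\mathbf{ALG})=\liminf_{n\to\infty}\ \inf_{v}\ \frac{\mathbb E\big(\mathrm{ALG}_n(v)\big)}{\mathbb E\big(\max_{1\le i\le n}v_{\sigma(i)}+\max_{n+1\le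 i\le 2n}v_{\sigma(i)}\big)}$$ be the limit performance of $\mathbf{ALG}$. Theorem. For every tie-breaking rule and every algorithm $\mathbf{ALG}$ for the Repeated Prophet Inequality, in the value-oblivious variant as well as in the values observed variant, $\mathrm{perf}(\mathbf{ALG})\le 0.502$. -/

import Mathlib

/-! # The Repeated Prophet Inequality

There are `n + n` items, indexed by `Fin (n + n)`. An arrival order is a permutation `σ` of
`Fin (n + n)`: the item `σ (Fin.castAdd n i)` is the one at position `i` of Phase 1, and
`σ (Fin.natAdd n j)` is the one at position `j` of Phase 2 (positions count from `0`). -/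

namespace RepeatedProphet

/-- An instance with `2n` items: a list of values `v₁ ≥ v₂ ≥ … ≥ v₂ₙ ≥ 0`, not all zero (so that
the competitive ratio is defined). -/
structure Instance (n : ℕ) where
  val : Fin (n + n) → ℝ
  antitone_val : Antitone val
  nonneg : ∀ i, 0 ≤ val i
  exists_pos : ∃ i, 0 < val i

/-- A tie-breaking rule, fixed before the first arrival: it attaches to every instance an absolute
ranking `place` of its items (`0` is the best place) which is consistent with the values. -/
structure TieBreaking where
  place : (n : ℕ) → Instance n → Equiv.Perm (Fin (n + n))
  consistent : ∀ (n : ℕ) (v : Instance n) (i j : Fin (n + n)),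
    v.val j < v.val i → place n v i < place n v j

/-- A deterministic stopping strategy. Its decisions use relative ranks only.

* `accept₁ h`: whether the item just presented in Phase 1 is accepted, where `h` lists the relative
  ranks, each at its time of arrival, of the items of Phase 1 revealed so far (the last entry
  belongs to the current item).
* `accept₂ h₁ h₂`: whether the item just presented in Phase 2 is accepted, where `h₁` lists the
  relative ranks of all the items that were revealed in Phase 1 and `h₂` those of the items of
  Phase 2 revealed so far (the last entry belongs to the current item). -/
structure Strategy where
  accept₁ : List ℕ → Bool
  accept₂ : List ℕ → List ℕ → Bool

section Decisions

/- Below, `a` gives for every time the absolute place of the item that arrives at that time. -/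

variable {n : ℕ} (a : Equiv.Perm (Fin (n + n)))

/-- The relative rank (`1` is the best) of the item at position `i` of Phase 1 among the items of
Phase 1 up to and including it. -/
def relRank₁ (i : Fin n) : ℕ :=
  (Finset.univ.filter fun l : Fin n => l ≤ i ∧ a (Fin.castAdd n l) ≤ a (Fin.castAdd n i)).card

/-- The relative rank (`1` is the best) of the item at position `j` of Phase 2 among the first `t`
items of Phase 1 and the items of Phase 2 up to and including it. -/
def relRank₂ (t : ℕ) (j : Fin n) : ℕ :=
  (Finset.univ.filter fun l : Fin n =>
      (l : ℕ) < t ∧ a (Fin.castAdd n l) ≤ a (Fin.natAdd n j)).card +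
    (Finset.univ.filter fun l : Fin n =>
      l ≤ j ∧ a (Fin.natAdd n l) ≤ a (Fin.natAdd n j)).card

/-- What the first `k` items of Phase 1 reveal. -/
def history₁ (k : ℕ) : List ℕ := ((List.finRange n).take k).map (relRank₁ a)

/-- What the first `k` items of Phase 2 reveal, if `t` items were revealed in Phase 1. -/
def history₂ (t k : ℕ) : List ℕ := ((List.finRange n).take k).map (relRank₂ a t)

/-- The position accepted in Phase 1, if any: the first one where the strategy says so. -/
def accepted₁ (s : Strategy) : Option (Fin n) :=
  (List.finRange n).find? fun i => s.accept₁ (history₁ a (i + 1))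

/-- The number of items revealed in Phase 1, which stops when an item is accepted. -/
def revealed₁ (s : Strategy) : ℕ :=
  match accepted₁ a s with
  | some i => i + 1
  | none => n

/-- The position accepted in Phase 2, if any. -/
def accepted₂ (s : Strategy) : Option (Fin n) :=
  (List.finRange n).find? fun j =>
    s.accept₂ (history₁ a (revealed₁ a s)) (history₂ a (revealed₁ a s) (j + 1))

end Decisions

/-- The expectation of `X σ` for a uniformly random permutation `σ`. -/
noncomputable def expect {n : ℕ} (X : Equiv.Perm (Fin (n + n)) → ℝ) : ℝ :=
  (∑ σ, X σ) / (Fintype.card (Equiv.Perm (Fin (n + n))) : ℝ)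

/-- The sum of the values accepted by the strategy `s` in the two phases when the items arrive in
the order `σ` (a phase without an accepted item yields `0`). -/
noncomputable def payoff (tie : TieBreaking) {n : ℕ} (v : Instance n) (s : Strategy)
    (σ : Equiv.Perm (Fin (n + n))) : ℝ :=
  ((accepted₁ (σ.trans (tie.place n v)) s).elim 0 fun i => v.val (σ (Fin.castAdd n i))) +
    (accepted₂ (σ.trans (tie.place n v)) s).elim 0 fun j => v.val (σ (Fin.natAdd n j))

/-- What the Prophet obtains: the sum of the largest values of the two phases. -/
noncomputable def prophet {n : ℕ} (v : Instance n) (σ : Equiv.Perm (Fin (n + n))) : ℝ :=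
  (⨆ i : Fin n, v.val (σ (Fin.castAdd n i))) + ⨆ j : Fin n, v.val (σ (Fin.natAdd n j))

/-- An algorithm of the values observed variant: for every size `n` and all values known in advance,
a (possibly randomized) strategy, i.e. a probability distribution on deterministic strategies. -/
def Algorithm : Type := (n : ℕ) → Instance n → PMF Strategy

/-- An algorithm of the value-oblivious variant: the strategy depends on the size only. -/
def ObliviousAlgorithm : Type := ℕ → PMF Strategy

/-- A value-oblivious algorithm, as an algorithm that ignores the values. -/
def ObliviousAlgorithm.toAlgorithm (A : ObliviousAlgorithm) : Algorithm := fun n _ => A n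

/-- The expected value `𝔼(ALGₙ(v))`, over the arrival order and the strategy's randomization. -/
noncomputable def expectedValue (tie : TieBreaking) (A : Algorithm) {n : ℕ} (v : Instance n) : ℝ :=
  ∑' s : Strategy, (A n v s).toReal * expect (payoff tie v s)

/-- The limit performance of an algorithm: the limit inferior, as `n → ∞`, of the worst ratio over
all instances with `2n` items. -/
noncomputable def limitPerformance (tie : TieBreaking) (A : Algorithm) : EReal :=
  Filter.liminf
    (fun n : ℕ => ⨅ v : Instance n, ((expectedValue tie A v / expect (prophet v) : ℝ) : EReal))
    Filter.atTop

end RepeatedProphet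

namespace RepeatedProphet

/-! ### Events that depend on the order of some positions -/

/-! Take the instance with one item of value 1 and all others of value 0. The Prophet gets at least
1, while a strategy is paid exactly when it accepts the best of all 2n items in one of the phases.
Knowing the values does not help beyond this, since decisions see only relative ranks; randomization
only averages. So it suffices to bound the winning probability of every deterministic strategy by
0.502 for infinitely many n.

Winning is a two-stage secretary problem. Each new item is the best so far among k items with
probability 1/k, independently of the earlier order (`count_and_lt`), and the best of k observed
items is the best of all with probability k/(2n) (`card_mul_count_and_min`). Hence, with values
multiplied by 2n, accepting the best of k items is worth k, and any sequence satisfying the Bellman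
inequalities bounds the value of a stopping problem (`stopping_bound`).

This is used twice. If Phase 1 reveals i + 1 items, Phase 2 is a secretary problem whose observer
has already seen these items; its value is at most `secondValue n i` (`secondPhase_bound`). In Phase
1, stopping yields this value on top of the chance that the accepted item is the best. The value of
Phase 2 is a concave function of i bounded by two affine ones, for which the Bellman equation has a
solution close to k log k; gluing gives a potential that starts at 1.004 n
(`exists_firstPotential`). Dividing by 2n yields 0.502 (`winCount_le`). -/

/-- The event `E` depends only on the order of the values that are at the positions in `S`. -/
def DependsOnOrder {N : ℕ} (S : Finset (Fin N)) (E : Equiv.Perm (Fin N) → Prop) : Prop :=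
  ∀ a b : Equiv.Perm (Fin N), (∀ x ∈ S, ∀ y ∈ S, a x ≤ a y ↔ b x ≤ b y) → E a → E b

/-- The number of permutations for which the event `E` holds. -/
noncomputable def count {N : ℕ} (E : Equiv.Perm (Fin N) → Prop) : ℕ :=
  Nat.card {a // E a}

section Counting

theorem count_eq_card_filter {N : ℕ} (E : Equiv.Perm (Fin N) → Prop) [DecidablePred E] :
    count E = (Finset.univ.filter E).card := by
  rw [count, Nat.card_eq_fintype_card, Fintype.card_subtype]

theorem count_mono {N : ℕ} {E F : Equiv.Perm (Fin N) → Prop} (h : ∀ a, E a → F a) :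
    count E ≤ count F := by
  classical
  rw [count_eq_card_filter, count_eq_card_filter]
  exact Finset.card_le_card fun a => by simpa using h a

theorem count_congr {N : ℕ} {E F : Equiv.Perm (Fin N) → Prop} (h : ∀ a, E a ↔ F a) :
    count E = count F := by
  rw [funext fun a => propext (h a)]

theorem count_and_add_count_and_not {N : ℕ} (E F : Equiv.Perm (Fin N) → Prop) :
    count (fun a => E a ∧ F a) + count (fun a => E a ∧ ¬ F a) = count E := by
  classical
  have h := Finset.card_filter_add_card_filter_not (s := Finset.univ.filter E) F
  rw [Finset.filter_filter, Finset.filter_filter] at h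
  simpa only [count_eq_card_filter] using h

variable {N : ℕ} {S T : Finset (Fin N)} {E F : Equiv.Perm (Fin N) → Prop}

theorem DependsOnOrder.mono (h : DependsOnOrder S E) (hST : S ⊆ T) : DependsOnOrder T E :=
  fun a b hab => h a b fun x hx y hy => hab x (hST hx) y (hST hy)

theorem DependsOnOrder.and (hE : DependsOnOrder S E) (hF : DependsOnOrder S F) :
    DependsOnOrder S fun a => E a ∧ F a :=
  fun a b hab h => ⟨hE a b hab h.1, hF a b hab h.2⟩

theorem DependsOnOrder.or (hE : DependsOnOrder S E) (hF : DependsOnOrder S F) :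
    DependsOnOrder S fun a => E a ∨ F a :=
  fun a b hab h => h.imp (hE a b hab) (hF a b hab)

theorem DependsOnOrder.const (p : Prop) : DependsOnOrder S fun _ => p :=
  fun _ _ _ h => h

theorem DependsOnOrder.not (hE : DependsOnOrder S E) : DependsOnOrder S fun a => ¬ E a :=
  fun a b hab h hb => h (hE b a (fun x hx y hy => (hab x hx y hy).symm) hb)

theorem DependsOnOrder.forall {ι : Sort*} {E : ι → Equiv.Perm (Fin N) → Prop}
    (hE : ∀ i, DependsOnOrder S (E i)) : DependsOnOrder S fun a => ∀ i, E i a :=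
  fun a b hab h i => hE i a b hab (h i)

theorem DependsOnOrder.min {x : Fin N} (hx : x ∈ S) :
    DependsOnOrder S fun a => ∀ y ∈ S, a x ≤ a y :=
  fun _ _ hab h y hy => (hab x hx y hy).1 (h y hy)

theorem DependsOnOrder.comp_rev (hE : DependsOnOrder S E) :
    DependsOnOrder S fun a => E (a.trans Fin.revPerm) :=
  fun a b hab h => hE _ _ (fun x hx y hy => by simpa using hab y hy x hx) h

/-- The number of positions in `S` that hold a smaller value than the position `x`. -/
def rankIn (S : Finset (Fin N)) (x : Fin N) (a : Equiv.Perm (Fin N)) : ℕ :=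
  (S.filter fun y => a y < a x).card

theorem rankIn_le_card (S : Finset (Fin N)) (x : Fin N) (a : Equiv.Perm (Fin N)) :
    rankIn S x a ≤ S.card :=
  Finset.card_le_card (Finset.filter_subset _ S)

theorem rankIn_comp_rev {x : Fin N} (hx : x ∉ S) (a : Equiv.Perm (Fin N)) :
    rankIn S x (a.trans Fin.revPerm) + rankIn S x a = S.card := by
  rw [rankIn, rankIn, ← Finset.card_filter_add_card_filter_not (s := S) (fun y => a y < a x),
    add_comm]
  congr 2
  refine Finset.filter_congr fun y hy => ?_
  have : a y ≠ a x := fun h => hx (a.injective h ▸ hy)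
  simp only [Equiv.trans_apply, Fin.revPerm_apply, Fin.rev_lt_rev, not_lt]
  exact ⟨le_of_lt, fun h => lt_of_le_of_ne h this.symm⟩

/-- Exchange the value at `x` with the next smaller value held in `S`, at position `y`. This
preserves the order within `S`, hence `E`, and lowers the rank of `x` by one. The exchange is
injective because `y` can be read off from the result. -/
theorem count_rankIn_succ_le (hE : DependsOnOrder S E) {x : Fin N} (hx : x ∉ S) (r : ℕ) :
    count (fun a => E a ∧ rankIn S x a = r + 1) ≤ count (fun a => E a ∧ rankIn S x a = r) := by
  classical
  have key : ∀ a : Equiv.Perm (Fin N), E a ∧ rankIn S x a = r + 1 →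
      ∃ b, (E b ∧ rankIn S x b = r) ∧ ∃ y ∈ S, a = (Equiv.swap x y).trans b ∧
        b x < b y ∧ ∀ z ∈ S, b x < b z → b y ≤ b z := by
    rintro a ⟨ha, hr⟩
    have hne : (S.filter fun y => a y < a x).Nonempty := by
      rw [← Finset.card_pos]; unfold rankIn at hr; omega
    obtain ⟨y, hy, hmax⟩ := Finset.exists_max_image _ a hne
    simp only [Finset.mem_filter] at hy hmax
    have hxy : x ≠ y := fun h => hx (h ▸ hy.1)
    set b := (Equiv.swap x y).trans a with hb
    have bx : b x = a y := by simp [hb]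
    have by' : b y = a x := by simp [hb]
    have bz : ∀ z ∈ S, z ≠ y → b z = a z := fun z hz hzy => by
      have hzx : z ≠ x := fun h => hx (h ▸ hz)
      simp [hb, Equiv.swap_apply_of_ne_of_ne hzx hzy]
    have hlow : ∀ z ∈ S, z ≠ y → (a z < a y ↔ a z < a x) := fun z hz hzy =>
      ⟨fun h => h.trans hy.2, fun h =>
        lt_of_le_of_ne (hmax z ⟨hz, h⟩) fun h' => hzy (a.injective h')⟩
    have hnex : ∀ z ∈ S, a z ≠ a x := fun z hz h => hx (a.injective h ▸ hz)
    refine ⟨b, ⟨hE a b (fun u hu w hw => ?_) ha, ?_⟩, y, hy.1, ?_, ?_, ?_⟩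
    · by_cases h1 : u = y
      · by_cases h2 : w = y
        · simp [h1, h2]
        · rw [h1, by', bz w hw h2, ← not_lt, ← not_lt, hlow w hw h2]
      · by_cases h2 : w = y
        · rw [h2, by', bz u hu h1]
          have h3 := hlow u hu h1
          have h4 : a u ≠ a y := fun h => h1 (a.injective h)
          rw [le_iff_lt_or_eq, le_iff_lt_or_eq, h3]
          simp [h4, hnex u hu]
        · rw [bz u hu h1, bz w hw h2]
    · have : (S.filter fun z => b z < b x) = (S.filter fun z => a z < a x).erase y := by
        ext z
        simp only [Finset.mem_filter, Finset.mem_erase]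
        by_cases hz : z = y
        · subst hz; simp [bx, by', hy.2.le]
        · constructor
          · rintro ⟨h1, h2⟩
            rw [bx, bz z h1 hz] at h2
            exact ⟨hz, h1, h2.trans hy.2⟩
          · rintro ⟨-, h1, h2⟩
            rw [bx, bz z h1 hz]
            exact ⟨h1, (hlow z h1 hz).2 h2⟩
      rw [rankIn, this, Finset.card_erase_of_mem (by simp [hy])]
      unfold rankIn at hr
      omega
    · ext z; simp [hb]
    · rw [bx, by']; exact hy.2
    · intro z hz h
      by_cases hzy : z = y
      · rw [hzy]
      · rw [by', bz z hz hzy]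
        rw [bx, bz z hz hzy] at h
        rw [← not_lt, ← hlow z hz hzy]
        exact h.not_gt
  choose f hf g hg h1 h2 h3 using key
  refine Nat.card_le_card_of_injective
    (fun a : {a // E a ∧ rankIn S x a = r + 1} =>
      (⟨f a a.2, hf a a.2⟩ : {a // E a ∧ rankIn S x a = r})) ?_
  rintro ⟨a, ha⟩ ⟨a', ha'⟩ haa'
  replace haa' : f a ha = f a' ha' := congrArg Subtype.val haa'
  -- After the exchange, `y` holds the smallest value in `S` above that of `x`, which determines it.
  have hgg : g a ha = g a' ha' := (f a ha).injective <| le_antisymm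
    (h3 a ha _ (hg a' ha') (haa' ▸ h2 a' ha'))
    (haa' ▸ h3 a' ha' _ (hg a ha) (haa' ▸ h2 a ha))
  exact Subtype.ext <| (h1 a ha).trans <| by rw [haa', hgg, ← h1 a' ha']

theorem count_comp_rev (E : Equiv.Perm (Fin N) → Prop) :
    count (fun a => E (a.trans Fin.revPerm)) = count E := by
  refine Nat.card_congr ((Equiv.equivCongr (Equiv.refl _) Fin.revPerm).subtypeEquiv fun a => ?_)
  rfl

/-- Reversing all values turns rank r into |S| - r, so the one-sided inequality also gives the
opposite one. -/
theorem count_rankIn_succ (hE : DependsOnOrder S E) {x : Fin N} (hx : x ∉ S) {r : ℕ}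
    (hr : r < S.card) :
    count (fun a => E a ∧ rankIn S x a = r + 1) = count (fun a => E a ∧ rankIn S x a = r) := by
  refine le_antisymm (count_rankIn_succ_le hE hx r) ?_
  have h := count_rankIn_succ_le hE.comp_rev hx (S.card - (r + 1))
  rw [← count_comp_rev fun a => E a ∧ rankIn S x a = r,
    ← count_comp_rev fun a => E a ∧ rankIn S x a = r + 1]
  refine (count_mono ?_).trans (h.trans (count_mono ?_)) <;> rintro a ⟨h1, h2⟩ <;>
    refine ⟨h1, ?_⟩ <;> have := rankIn_comp_rev hx a <;> omega

/-- A new position holds the smallest value so far with probability `1 / (|S| + 1)`, independently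
of the order of the values at the positions in `S`. -/
theorem count_and_lt (hE : DependsOnOrder S E) {x : Fin N} (hx : x ∉ S) :
    (S.card + 1) * count (fun a => E a ∧ ∀ y ∈ S, a x < a y) = count E := by
  classical
  have h0 : ∀ r ≤ S.card, count (fun a => E a ∧ rankIn S x a = r) =
      count (fun a => E a ∧ ∀ y ∈ S, a x < a y) := by
    intro r hr
    induction r with
    | zero =>
      refine count_congr fun a => and_congr_right fun _ => ?_
      rw [rankIn, Finset.card_eq_zero, Finset.filter_eq_empty_iff]
      refine forall₂_congr fun y hy => ?_
      have : a x ≠ a y := fun h => hx (a.injective h ▸ hy)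
      rw [not_lt, this.le_iff_lt]
    | succ r ih => rw [count_rankIn_succ hE hx hr, ih (by omega)]
  have h1 : count E = ∑ r ∈ Finset.range (S.card + 1), count (fun a => E a ∧ rankIn S x a = r) := by
    have h := Finset.card_eq_sum_card_fiberwise (s := Finset.univ.filter E) (f := rankIn S x)
      (t := Finset.range (S.card + 1)) fun a _ => by
        simpa [Nat.lt_succ_iff] using rankIn_le_card S x a
    simpa only [count_eq_card_filter, Finset.filter_filter] using h
  rw [h1, Finset.sum_congr rfl fun r hr => h0 r (by simpa [Nat.lt_succ_iff] using hr)]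
  simp

/-- The smallest value at the positions in `S` is the smallest one at the positions in a larger set
`T` with probability `|S| / |T|`, independently of the order of the values in `S`. -/
theorem card_mul_count_and_min (hE : DependsOnOrder S E) {x : Fin N} (hx : x ∈ S) (hST : S ⊆ T) :
    T.card * count (fun a => E a ∧ ∀ y ∈ T, a x ≤ a y) =
      S.card * count (fun a => E a ∧ ∀ y ∈ S, a x ≤ a y) := by
  classical
  suffices h : ∀ R : Finset (Fin N), Disjoint S R →
      (S ∪ R).card * count (fun a => E a ∧ ∀ y ∈ S ∪ R, a x ≤ a y) =
      S.card * count (fun a => E a ∧ ∀ y ∈ S, a x ≤ a y) by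
    simpa [Finset.union_sdiff_of_subset hST] using h (T \ S) Finset.disjoint_sdiff
  intro R
  induction R using Finset.induction_on with
  | empty => simp
  | insert z R hz ih =>
    intro hd
    rw [Finset.disjoint_insert_right] at hd
    rw [← ih hd.2, Finset.union_insert]
    have hzU : z ∉ S ∪ R := by simp [hd.1, hz]
    have hxU : x ∈ S ∪ R := Finset.mem_union_left _ hx
    set U := S ∪ R
    have hEU : DependsOnOrder U fun a => E a ∧ ∀ y ∈ U, a x ≤ a y :=
      (hE.mono Finset.subset_union_left).and (DependsOnOrder.min hxU)
    have h1 := count_and_lt hEU hzU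
    have h2 := count_and_add_count_and_not (fun a => E a ∧ ∀ y ∈ U, a x ≤ a y)
      fun a => ∀ y ∈ U, a z < a y
    have h3 : count (fun a => (E a ∧ ∀ y ∈ U, a x ≤ a y) ∧ ¬ ∀ y ∈ U, a z < a y) =
        count (fun a => E a ∧ ∀ y ∈ insert z U, a x ≤ a y) := by
      refine count_congr fun a => ?_
      constructor
      · rintro ⟨⟨hEa, hmin⟩, hz⟩
        refine ⟨hEa, (Finset.forall_mem_insert _ _ _).2 ⟨?_, hmin⟩⟩
        by_contra hlt
        exact hz fun w hw => (not_le.1 hlt).trans_le (hmin w hw)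
      · rintro ⟨h1, h2⟩
        exact ⟨⟨h1, fun y hy => h2 y (Finset.mem_insert_of_mem hy)⟩, fun h =>
          (h x hxU).not_ge (h2 z (Finset.mem_insert_self _ _))⟩
    rw [h3] at h2
    rw [Finset.card_insert_of_notMem hzU]
    nlinarith

end Counting

/-! ### Optimal stopping -/

/-- The first time at which one of the events `q` holds is `i`. -/
def FirstAt {α : Type*} (q : ℕ → α → Prop) (i : ℕ) (a : α) : Prop :=
  q i a ∧ ∀ l < i, ¬ q l a

/-- A potential `h` that satisfies the Bellman inequalities bounds the value of a stopping
problem. -/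
theorem sum_le_potential (n : ℕ) (r v h p x y : ℕ → ℝ)
    (hp : ∀ i < n, 0 ≤ p i) (hpx : ∀ i < n, p i ≤ x i) (hpy : ∀ i < n, r i * p i ≤ y i)
    (hxy : ∀ i < n, y (i + 1) = y i - x i) (hr : ∀ i < n, 0 < r i)
    (hv : ∀ i < n, v i ≤ h (i + 1)) (hanti : ∀ i < n, h (i + 1) ≤ h i)
    (hstep : ∀ i < n, r i + v i - h (i + 1) ≤ r i * (h i - h (i + 1))) :
    ∑ i ∈ Finset.range n, (r i * p i + v i * x i) + h n * y n ≤ h 0 * y 0 := by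
  induction n with
  | zero => simp
  | succ n ih =>
    have := ih (fun i hi => hp i (by omega)) (fun i hi => hpx i (by omega))
      (fun i hi => hpy i (by omega)) (fun i hi => hxy i (by omega)) (fun i hi => hr i (by omega))
      (fun i hi => hv i (by omega)) (fun i hi => hanti i (by omega))
      (fun i hi => hstep i (by omega))
    refine le_trans ?_ this
    have hn := Nat.lt_succ_self n
    rw [Finset.sum_range_succ, hxy n hn]
    -- Linear programming duality: the constraints `r p ≤ y` and `p ≤ x` receive the multipliers `h
    -- n - h (n + 1)` and `h (n + 1) - v n`, both nonnegative.
    have h1 := mul_le_mul_of_nonneg_right (hstep n hn) (hp n hn)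
    have h2 := mul_le_mul_of_nonneg_right (hpy n hn) (sub_nonneg.2 (hanti n hn))
    have h3 := mul_le_mul_of_nonneg_left (hpx n hn) (sub_nonneg.2 (hv n hn))
    nlinarith

/-- The value of a stopping problem in which the positions `e 0`, `e 1`, … are revealed one by one
to someone who knows the order of the values at the positions in `S 0`, if stopping at the smallest
of all values yields `N` and stopping at time `i` yields in addition `v i`. -/
theorem stopping_bound {N : ℕ} (n : ℕ) (S : ℕ → Finset (Fin N)) (e : ℕ → Fin N)
    (he : ∀ i < n, e i ∉ S i) (hS : ∀ i < n, S (i + 1) = insert (e i) (S i))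
    (Ω : Equiv.Perm (Fin N) → Prop) (q : ℕ → Equiv.Perm (Fin N) → Prop)
    (hΩ : DependsOnOrder (S 0) Ω) (hq : ∀ i < n, DependsOnOrder (S (i + 1)) (q i))
    (v h : ℕ → ℝ)
    (hv : ∀ i < n, v i ≤ h (i + 1)) (hanti : ∀ i < n, h (i + 1) ≤ h i)
    (hstep : ∀ i < n, ((S i).card + 1 : ℝ) + v i - h (i + 1) ≤
      ((S i).card + 1 : ℝ) * (h i - h (i + 1))) :
    ∑ i ∈ Finset.range n,
      ((N : ℝ) * count (fun a => (Ω a ∧ FirstAt q i a) ∧ ∀ y, a (e i) ≤ a y) +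
        v i * count (fun a => Ω a ∧ FirstAt q i a)) +
      h n * count (fun a => Ω a ∧ ∀ l < n, ¬ q l a) ≤ h 0 * count Ω := by
  have hmono : ∀ i j, i ≤ j → j ≤ n → S i ⊆ S j := by
    intro i j hij hj
    induction j, hij using Nat.le_induction with
    | base => rfl
    | succ j hij ih =>
      exact (ih (by omega)).trans (by rw [hS j hj]; exact Finset.subset_insert _ _)
  have hnot : ∀ i ≤ n, DependsOnOrder (S i) fun a => Ω a ∧ ∀ l < i, ¬ q l a := fun i hi =>
    (hΩ.mono (hmono 0 i (by omega) hi)).and <| DependsOnOrder.forall fun l =>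
      DependsOnOrder.forall fun hl => ((hq l (by omega)).mono (hmono _ _ hl hi)).not
  have hfirst : ∀ i < n, DependsOnOrder (S (i + 1)) fun a => Ω a ∧ FirstAt q i a := fun i hi =>
    (hΩ.mono (hmono 0 _ (by omega) hi)).and <| (hq i hi).and <| DependsOnOrder.forall fun l =>
      DependsOnOrder.forall fun hl =>
        ((hq l (by omega)).mono (hmono (l + 1) (i + 1) (by omega) hi)).not
  have hcard : ∀ i < n, (S (i + 1)).card = (S i).card + 1 := fun i hi => by
    rw [hS i hi, Finset.card_insert_of_notMem (he i hi)]
  have hmem : ∀ i < n, e i ∈ S (i + 1) := fun i hi => by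
    rw [hS i hi]; exact Finset.mem_insert_self _ _
  have main := sum_le_potential n (fun i => (S i).card + 1) v h
    (fun i => count (fun a => (Ω a ∧ FirstAt q i a) ∧ ∀ y ∈ S (i + 1), a (e i) ≤ a y))
    (fun i => count (fun a => Ω a ∧ FirstAt q i a))
    (fun i => count (fun a => Ω a ∧ ∀ l < i, ¬ q l a))
    (fun i _ => Nat.cast_nonneg _) (fun i _ => Nat.cast_le.2 (count_mono fun a h => h.1))
    (fun i hi => ?_) (fun i _ => ?_) (fun i _ => by positivity) hv hanti hstep
  · refine le_trans (le_of_eq ?_) (main.trans (le_of_eq ?_))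
    · congr 1
      refine Finset.sum_congr rfl fun i hi => ?_
      rw [Finset.mem_range] at hi
      congr 1
      have := card_mul_count_and_min (hfirst i hi) (hmem i hi) (Finset.subset_univ _)
      simp only [Finset.mem_univ, forall_const, Finset.card_univ, Fintype.card_fin,
        hcard i hi] at this
      exact_mod_cast this
    · simp
  · have h1 := count_and_lt (hnot i hi.le) (he i hi)
    have h2 : count (fun a => (Ω a ∧ FirstAt q i a) ∧ ∀ y ∈ S (i + 1), a (e i) ≤ a y) ≤
        count (fun a => (Ω a ∧ ∀ l < i, ¬ q l a) ∧ ∀ y ∈ S i, a (e i) < a y) := by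
      refine count_mono fun a ⟨⟨h1, h2⟩, h3⟩ => ⟨⟨h1, h2.2⟩, fun y hy => ?_⟩
      refine lt_of_le_of_ne (h3 y (hmono i (i + 1) (by omega) hi hy)) fun h => ?_
      exact he i hi (a.injective h ▸ hy)
    have h3 := (Nat.mul_le_mul_left ((S i).card + 1) h2).trans h1.le
    exact_mod_cast h3
  · have h1 := count_and_add_count_and_not (fun a => Ω a ∧ ∀ l < i, ¬ q l a) (q i)
    have h2 : count (fun a => (Ω a ∧ ∀ l < i, ¬ q l a) ∧ q i a) =
        count (fun a => Ω a ∧ FirstAt q i a) :=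
      count_congr fun a => by unfold FirstAt; tauto
    have h3 : count (fun a => (Ω a ∧ ∀ l < i, ¬ q l a) ∧ ¬ q i a) =
        count (fun a => Ω a ∧ ∀ l < i + 1, ¬ q l a) :=
      count_congr fun a => by
        rw [and_assoc]
        refine and_congr_right fun _ => ⟨fun h l hl => ?_, fun h =>
          ⟨fun l hl => h l (by omega), h i (by omega)⟩⟩
        rcases Nat.lt_succ_iff_lt_or_eq.1 hl with hl | rfl
        exacts [h.1 l hl, h.2]
    rw [h2, h3] at h1
    rw [eq_sub_iff_add_eq, add_comm]
    exact_mod_cast h1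

/-! ### Potentials for the two phases -/

theorem one_le_mul_log_sub {L u : ℝ} (hL : 0 < L) (hu : 0 < u) :
    1 ≤ (u + 1) * (Real.log (L / u) - Real.log (L / (u + 1))) := by
  rw [← Real.log_div (by positivity) (by positivity)]
  have h1 : L / u / (L / (u + 1)) = (u + 1) / u := by field_simp
  have h2 := Real.one_sub_inv_le_log_of_pos (show 0 < (u + 1) / u by positivity)
  rw [h1]
  have h3 : 1 - ((u + 1) / u)⁻¹ = 1 / (u + 1) := by field_simp; ring
  rw [h3, div_le_iff₀ (by positivity)] at h2
  linarith

/-- The tangents of the concave function `u ↦ u log (L / u)` lie above it. -/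
theorem mul_log_div_le {L u z : ℝ} (hL : 0 < L) (hu : 0 < u) (hz : 0 < z) :
    u * Real.log (L / u) ≤ u * (Real.log z - 1) + L / z := by
  have h := Real.log_le_sub_one_of_pos (show 0 < L / u / z by positivity)
  rw [Real.log_div (by positivity) hz.ne'] at h
  have h1 := mul_le_mul_of_nonneg_left h hu.le
  have h2 : u * (L / u / z - 1) = L / z - u := by field_simp
  linarith

/-- The potential of the classical secretary problem with `L + 1` items, after `u + 1` of them. -/
noncomputable def secretaryPotential (L u : ℝ) : ℝ :=
  if u < L / Real.exp 1 then 1 + L / Real.exp 1 else (u + 1) * Real.log (L / u)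

theorem mul_log_div_le_div_exp {L u : ℝ} (hL : 0 < L) (hu : 0 < u) :
    u * Real.log (L / u) ≤ L / Real.exp 1 := by
  simpa using mul_log_div_le hL hu (Real.exp_pos 1)

theorem log_div_le_one {L u : ℝ} (hL : 0 < L) (h : L / Real.exp 1 ≤ u) :
    Real.log (L / u) ≤ 1 := by
  have hu : 0 < u := lt_of_lt_of_le (by positivity) h
  rw [Real.log_le_iff_le_exp (by positivity), div_le_iff₀ hu]
  rwa [div_le_iff₀ (Real.exp_pos 1), mul_comm] at h

/-- These are the Bellman inequalities for the arrival of item number u + 2. Monotonicity follows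
from the first inequality as soon as the potential is at most u + 2, that is, when accepting the
best so far is no worse than continuing. -/
theorem secretaryPotential_step {L u : ℝ} (hL : 0 < L) (hu : 0 ≤ u) :
    (u + 2) - secretaryPotential L (u + 1) ≤
      (u + 2) * (secretaryPotential L u - secretaryPotential L (u + 1)) ∧
    secretaryPotential L (u + 1) ≤ secretaryPotential L u := by
  have hanti : ∀ g g' : ℝ, (u + 2) - g' ≤ (u + 2) * (g - g') → g' ≤ u + 2 → g' ≤ g := by
    intro g g' h1 h2
    by_contra hlt
    nlinarith
  unfold secretaryPotential
  by_cases h1 : u + 1 < L / Real.exp 1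
  · rw [if_pos h1, if_pos (by linarith)]
    constructor <;> linarith
  · rw [if_neg h1]
    rw [not_lt] at h1
    have hlog := log_div_le_one hL h1
    have h3 : (u + 1 + 1) * Real.log (L / (u + 1)) ≤ u + 2 := by nlinarith
    by_cases h2 : u < L / Real.exp 1
    · rw [if_pos h2]
      refine and_iff_left_of_imp (fun h => hanti _ _ h h3) |>.2 ?_
      have := mul_log_div_le_div_exp hL (show 0 < u + 1 by linarith)
      nlinarith
    · rw [if_neg h2]
      refine and_iff_left_of_imp (fun h => hanti _ _ h h3) |>.2 ?_
      have hu' : 0 < u := lt_of_lt_of_le (by positivity) (not_lt.1 h2)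
      have := one_le_mul_log_sub hL hu'
      nlinarith

theorem secretaryPotential_nonneg {L u : ℝ} (hL : 0 < L) (hu : u ≤ L) :
    0 ≤ secretaryPotential L u := by
  unfold secretaryPotential
  split_ifs with h
  · positivity
  · have hu' : 0 < u := lt_of_lt_of_le (by positivity) (not_lt.1 h)
    exact mul_nonneg (by linarith) (Real.log_nonneg ((one_le_div hu').2 hu))

theorem secretaryPotential_le {L u : ℝ} (hL : 0 < L) :
    secretaryPotential L u ≤ 1 + L / Real.exp 1 := by
  unfold secretaryPotential
  split_ifs with h
  · rfl
  · rw [not_lt] at h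
    have hu : 0 < u := lt_of_lt_of_le (by positivity) h
    have := log_div_le_one hL h
    have := mul_log_div_le_div_exp hL hu
    linarith

/-- This uses the tangent at u = L / 2. For L = i + n and u = i the contact point is i = n, so the
bound is sharpest at the end of Phase 1, and it is affine in i as `firstPotential` requires. -/
theorem secretaryPotential_le_of_le {L u : ℝ} (hL : 0 < L) (h : L / Real.exp 1 ≤ u) :
    secretaryPotential L u ≤ 1 + u * (Real.log 2 - 1) + L / 2 := by
  rw [secretaryPotential, if_neg (not_lt.2 h)]
  have hu : 0 < u := lt_of_lt_of_le (by positivity) h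
  have := log_div_le_one hL h
  have := mul_log_div_le hL hu (show (0 : ℝ) < 2 by norm_num)
  linarith

/-- A potential of the first phase where the second one is worth `α + β k` after `k` items. -/
noncomputable def firstPotential (K α β d k : ℝ) : ℝ :=
  α + (1 + β) * k * Real.log (K / (k - 1)) + d * k

/-- For large k the Bellman equation becomes k g' = g - α - (1 + β) k, solved by α + c k - (1 + β) k
log k. Replacing k by k - 1 inside the logarithm makes the discrete inequality exact. `K` and `d`
together encode the single constant c. -/
theorem firstPotential_step {K α β d k : ℝ} (hK : 0 < K) (hβ : 0 ≤ β) (hk : 1 < k) :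
    (k + 1) + (α + β * (k + 1)) - firstPotential K α β d (k + 1) ≤
      (k + 1) * (firstPotential K α β d k - firstPotential K α β d (k + 1)) := by
  have h := one_le_mul_log_sub hK (show 0 < k - 1 by linarith)
  unfold firstPotential
  rw [sub_add_cancel] at h
  rw [add_sub_cancel_right]
  have := mul_le_mul_of_nonneg_left h (show 0 ≤ (1 + β) * (k + 1) by positivity)
  nlinarith

theorem le_firstPotential {K α β d k : ℝ} (hβ : 0 ≤ β) (hk : 1 < k) (hkK : k - 1 ≤ K)
    (hd : β ≤ d) : α + β * k ≤ firstPotential K α β d k := by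
  have h := Real.log_nonneg ((one_le_div (show 0 < k - 1 by linarith)).2 hkK)
  unfold firstPotential
  have := mul_nonneg (show 0 ≤ (1 + β) * k by positivity) h
  nlinarith

theorem firstPotential_le {K α β d k l : ℝ} (hβ : 0 ≤ β) (hk : 1 < k)
    (hl : Real.log (K / (k - 1)) ≤ l) (hd : d ≤ (1 + β) * (1 - l)) :
    firstPotential K α β d k ≤ k + (α + β * k) := by
  unfold firstPotential
  have h1 := mul_le_mul_of_nonneg_left hl (show 0 ≤ (1 + β) * k by positivity)
  have h2 := mul_le_mul_of_nonneg_right hd (show 0 ≤ k by linarith)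
  nlinarith

/-- The condition β ≤ d keeps the potential above the value of Phase 2; the upper bound on d makes
accepting the best so far at least as good as continuing, which forces the potential to decrease.
Only an upper bound of the potential by `h` is needed at i, so that pieces can be glued. -/
theorem step_of_firstPotential {K α β d i l w h : ℝ} (hK : 0 < K) (hβ : 0 ≤ β) (hi : 1 < i)
    (hiK : i ≤ K) (hd : β ≤ d) (hl : Real.log (K / i) ≤ l) (hdl : d ≤ (1 + β) * (1 - l))
    (hw : w ≤ α + β * (i + 1)) (hh : firstPotential K α β d i ≤ h) :
    w ≤ firstPotential K α β d (i + 1) ∧ firstPotential K α β d (i + 1) ≤ h ∧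
      (i + 1) + w - firstPotential K α β d (i + 1) ≤
        (i + 1) * (h - firstPotential K α β d (i + 1)) := by
  have h1 := firstPotential_step (α := α) (d := d) hK hβ hi
  have h2 := le_firstPotential (α := α) (K := K) hβ (show 1 < i + 1 by linarith) (by linarith) hd
  have h3 := firstPotential_le (α := α) (K := K) (l := l) hβ (show 1 < i + 1 by linarith)
    (by rwa [add_sub_cancel_right]) hdl
  refine ⟨by linarith, ?_, by nlinarith⟩
  by_contra hlt
  nlinarith

/-! ### Numerical bounds, from Taylor polynomials of the exponential -/

theorem log_four_div_three_le : Real.log (4 / 3) ≤ 0.28769 := by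
  rw [Real.log_le_iff_le_exp (by norm_num)]
  refine le_trans ?_ (Real.sum_le_exp_of_nonneg (by norm_num) 8)
  norm_num [Finset.sum_range_succ, Nat.factorial]

theorem log_fifty_div_thirty_one_le : Real.log (50 / 31) ≤ 0.47804 := by
  rw [Real.log_le_iff_le_exp (by norm_num)]
  refine le_trans ?_ (Real.sum_le_exp_of_nonneg (by norm_num) 8)
  norm_num [Finset.sum_range_succ, Nat.factorial]

theorem inv_exp_one_bounds : 0.367879 ≤ (Real.exp 1)⁻¹ ∧ (Real.exp 1)⁻¹ ≤ 0.36788 := by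
  have h1 := Real.exp_one_gt_d9
  have h2 := Real.exp_one_lt_d9
  constructor
  · rw [le_inv_comm₀ (by norm_num) (by positivity)]
    exact h2.le.trans (by norm_num)
  · rw [inv_le_comm₀ (by positivity) (by norm_num)]
    exact le_trans (by norm_num) h1.le

/-- A potential of the first phase with value `1.004 n`, if `w i` is what the second one is worth
after `i + 1` items. -/
theorem exists_firstPotential (j n : ℕ) (hj : 1000 ≤ j) (hn : n = 1000 * j + 1) (w : ℕ → ℝ)
    (hw₁ : ∀ i < n, w i ≤ 1 + (i + n : ℝ) / Real.exp 1)
    (hw₂ : ∀ i < n, (i + n : ℝ) / Real.exp 1 ≤ i →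
      w i ≤ 1 + i * (Real.log 2 - 1) + (i + n : ℝ) / 2) :
    ∃ h : ℕ → ℝ, h 0 = 1.004 * n ∧ (∀ i < n, w i ≤ h (i + 1)) ∧ (∀ i < n, h (i + 1) ≤ h i) ∧
      ∀ i < n, (i + 1 : ℝ) + w i - h (i + 1) ≤ (i + 1 : ℝ) * (h i - h (i + 1)) := by
  obtain ⟨he₁, he₂⟩ := inv_exp_one_bounds
  simp only [div_eq_mul_inv _ (Real.exp 1)] at hw₁ hw₂
  set ε := (Real.exp 1)⁻¹
  have hl₁ := Real.log_two_gt_d9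
  have hl₂ := Real.log_two_lt_d9
  have hB := log_four_div_three_le
  have hA := log_fifty_div_thirty_one_le
  have hJ : (1000 : ℝ) ≤ j := by exact_mod_cast hj
  have hN : (n : ℝ) = 1000 * j + 1 := by rw [hn]; push_cast; ring
  set β := Real.log 2 - 1 / 2 with hβ
  -- `P` and `Q` belong to the two affine bounds of `w`, rewritten in k = i + 1. The bounds cross
  -- near i = 0.756 n, hence the change at 750 j. The slope 0.71265 is large enough for `Q ≤ P`
  -- there and small enough for `step_of_firstPotential` with l = 0.47804.
  set P := firstPotential (750 * j) (1 + (n - 1) * ε) ε 0.71265 with hP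
  set Q := firstPotential (1000 * j) (1 - β + n / 2) β β with hQ
  have hcP : P (465 * j + 1) ≤ 1.004 * n := by
    have : (750 * j : ℝ) / (465 * j + 1 - 1) = 50 / 31 := by field_simp; ring
    rw [hP, firstPotential, this]
    have h1 : (1 + ε) * Real.log (50 / 31) ≤ 1.36788 * 0.47804 := by
      refine mul_le_mul (by linarith) hA (Real.log_nonneg (by norm_num)) (by norm_num)
    nlinarith
  have hPQ : Q (750 * j + 1) ≤ P (750 * j + 1) := by
    have h1 : (750 * j : ℝ) / (750 * j + 1 - 1) = 1 := by field_simp; norm_num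
    have h2 : (1000 * j : ℝ) / (750 * j + 1 - 1) = 4 / 3 := by field_simp; ring
    rw [hP, hQ, firstPotential, firstPotential, h1, h2, Real.log_one]
    have h1 : (1 + β) * Real.log (4 / 3) ≤ 1.1931472 * 0.28769 := by
      refine mul_le_mul (by linarith) hB (Real.log_nonneg (by norm_num)) (by norm_num)
    nlinarith
  -- Up to 465 j + 1 the potential can stay constant: accepting the best so far is worth at most
  -- about (0.465 + 1.465 / e) n, just below 1.004 n. Since j ≥ 1000, the additive constants are
  -- absorbed.
  set h : ℕ → ℝ := fun k => if k ≤ 465 * j + 1 then 1.004 * n else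
    if k ≤ 750 * j + 1 then P k else Q k with hh
  suffices H : ∀ i < n, w i ≤ h (i + 1) ∧ h (i + 1) ≤ h i ∧
      (i + 1 : ℝ) + w i - h (i + 1) ≤ (i + 1 : ℝ) * (h i - h (i + 1)) from
    ⟨h, by simp [hh], fun i hi => (H i hi).1, fun i hi => (H i hi).2.1, fun i hi => (H i hi).2.2⟩
  intro i hi
  have hi' : (i : ℝ) ≤ 1000 * j := by
    have : i ≤ 1000 * j := by omega
    exact_mod_cast this
  have hi0 : (0 : ℝ) ≤ i := Nat.cast_nonneg i
  by_cases hi1 : i + 1 ≤ 465 * j + 1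
  · have h1 : h i = 1.004 * n := if_pos (by omega)
    have h2 : h (i + 1) = 1.004 * n := if_pos hi1
    have h3 : (i : ℝ) ≤ 465 * j := by
      have : i ≤ 465 * j := by omega
      exact_mod_cast this
    have h4 := hw₁ i hi
    have h5 : (i + n : ℝ) * ε ≤ (465 * j + n) * 0.36788 := by
      refine mul_le_mul (by linarith) he₂ (by linarith) (by positivity)
    rw [h1, h2]
    refine ⟨by linarith, le_rfl, by linarith⟩
  have h3 : (465 * j + 1 : ℝ) ≤ i := by
    have : 465 * j + 1 ≤ i := by omega
    exact_mod_cast this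
  by_cases hi2 : i + 1 ≤ 750 * j + 1
  · have h2 : h (i + 1) = P (i + 1) := by simp only [hh]; rw [if_neg hi1, if_pos hi2]; push_cast; rfl
    have h1 : P i ≤ h i := by
      simp only [hh]
      split_ifs with h4
      · have : i = 465 * j + 1 := by omega
        rw [this]; push_cast; exact hcP
      · rfl
      · omega
    have h4 : (i : ℝ) ≤ 750 * j := by
      have : i ≤ 750 * j := by omega
      exact_mod_cast this
    rw [h2]
    refine step_of_firstPotential (l := 0.47804) (by linarith) (by linarith) (by linarith) h4
      (by linarith) ?_ (by linarith) (by linarith [hw₁ i hi]) h1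
    refine le_trans (Real.log_le_log (div_pos (by linarith) (by linarith)) ?_) hA
    rw [div_le_div_iff₀ (by linarith) (by norm_num)]
    linarith
  · have h4 : (750 * j + 1 : ℝ) ≤ i := by
      have : 750 * j + 1 ≤ i := by omega
      exact_mod_cast this
    have h2 : h (i + 1) = Q (i + 1) := by
      simp only [hh]; rw [if_neg hi1, if_neg hi2]; push_cast; rfl
    have h1 : Q i ≤ h i := by
      simp only [hh]
      split_ifs with h5 h6
      · omega
      · have : i = 750 * j + 1 := by omega
        rw [this]; push_cast; exact hPQ
      · rfl
    have h5 := hw₂ i hi (by nlinarith)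
    rw [h2]
    refine step_of_firstPotential (l := 0.28769) (by linarith) (by linarith) (by linarith) hi'
      le_rfl ?_ (by linarith) (by rw [hβ]; linarith) h1
    refine le_trans (Real.log_le_log (div_pos (by linarith) (by linarith)) ?_) hB
    rw [div_le_div_iff₀ (by linarith) (by norm_num)]
    linarith

/-! ### The events of the process -/

section Events

variable {n : ℕ}

theorem find?_finRange_eq_some_iff (p : Fin n → Bool) (i : Fin n) :
    (List.finRange n).find? p = some i ↔ p i = true ∧ ∀ l : Fin n, l < i → p l = false := by
  rw [List.find?_eq_some_iff_getElem]
  simp only [List.getElem_finRange, List.length_finRange, Bool.not_eq_true']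
  constructor
  · rintro ⟨h1, k, hk, rfl, h2⟩
    exact ⟨h1, fun l hl => h2 l hl⟩
  · rintro ⟨h1, h2⟩
    exact ⟨h1, i, i.2, rfl, fun l hl => h2 _ hl⟩

theorem find?_finRange_eq_none_iff (p : Fin n → Bool) :
    (List.finRange n).find? p = none ↔ ∀ l : Fin n, p l = false := by
  simp

/-- The strategy accepts in Phase 1 the item at position `i`, if it gets there. -/
def Accepts₁ (s : Strategy) (i : ℕ) (a : Equiv.Perm (Fin (n + n))) : Prop :=
  s.accept₁ (history₁ a (i + 1)) = true

/-- The strategy accepts in Phase 2 the item at position `j`, if it gets there and `t` items were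
revealed in Phase 1. -/
def Accepts₂ (s : Strategy) (t j : ℕ) (a : Equiv.Perm (Fin (n + n))) : Prop :=
  s.accept₂ (history₁ a t) (history₂ a t (j + 1)) = true

theorem accepted₁_eq_some_iff {a : Equiv.Perm (Fin (n + n))} {s : Strategy} {i : Fin n} :
    accepted₁ a s = some i ↔ FirstAt (Accepts₁ s) i a := by
  rw [accepted₁, find?_finRange_eq_some_iff, FirstAt]
  refine and_congr_right fun _ => ⟨fun h l hl => ?_, fun h l hl => ?_⟩
  · simpa [Accepts₁] using h ⟨l, hl.trans i.2⟩ hl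
  · simpa [Accepts₁] using h l hl

theorem accepted₁_eq_none_iff {a : Equiv.Perm (Fin (n + n))} {s : Strategy} :
    accepted₁ a s = none ↔ ∀ l < n, ¬ Accepts₁ s l a := by
  rw [accepted₁, find?_finRange_eq_none_iff]
  refine ⟨fun h l hl => ?_, fun h l => ?_⟩
  · simpa [Accepts₁] using h ⟨l, hl⟩
  · simpa [Accepts₁] using h l l.2

theorem accepted₂_eq_some_iff {a : Equiv.Perm (Fin (n + n))} {s : Strategy} {j : Fin n} :
    accepted₂ a s = some j ↔ FirstAt (Accepts₂ s (revealed₁ a s)) j a := by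
  rw [accepted₂, find?_finRange_eq_some_iff, FirstAt]
  refine and_congr_right fun _ => ⟨fun h l hl => ?_, fun h l hl => ?_⟩
  · simpa [Accepts₂] using h ⟨l, hl.trans j.2⟩ hl
  · simpa [Accepts₂] using h l hl

theorem revealed₁_eq_of_some {a : Equiv.Perm (Fin (n + n))} {s : Strategy} {i : Fin n}
    (h : accepted₁ a s = some i) : revealed₁ a s = i + 1 := by
  simp [revealed₁, h]

theorem revealed₁_eq_of_none {a : Equiv.Perm (Fin (n + n))} {s : Strategy}
    (h : accepted₁ a s = none) : revealed₁ a s = n := by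
  simp [revealed₁, h]

theorem revealed₁_le (a : Equiv.Perm (Fin (n + n))) (s : Strategy) : revealed₁ a s ≤ n := by
  rcases h : accepted₁ a s with _ | i
  · exact (revealed₁_eq_of_none h).le
  · rw [revealed₁_eq_of_some h]; exact i.2

theorem revealed₁_pos (hn : 0 < n) (a : Equiv.Perm (Fin (n + n))) (s : Strategy) :
    0 < revealed₁ a s := by
  rcases h : accepted₁ a s with _ | i
  · rwa [revealed₁_eq_of_none h]
  · rw [revealed₁_eq_of_some h]; omega

theorem revealed₁_eq_succ_iff {a : Equiv.Perm (Fin (n + n))} {s : Strategy} {i : ℕ} (hi : i < n) :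
    revealed₁ a s = i + 1 ↔
      FirstAt (Accepts₁ s) i a ∨ (i + 1 = n ∧ ∀ l < n, ¬ Accepts₁ s l a) := by
  rcases h : accepted₁ a s with _ | l
  · have h1 := accepted₁_eq_none_iff.1 h
    rw [revealed₁_eq_of_none h]
    constructor
    · exact fun h2 => Or.inr ⟨h2.symm, h1⟩
    · rintro (h2 | h2)
      · exact absurd h2.1 (h1 i hi)
      · exact h2.1.symm
  · have h1 := accepted₁_eq_some_iff.1 h
    rw [revealed₁_eq_of_some h]
    constructor
    · intro h2
      obtain rfl : (l : ℕ) = i := by omega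
      exact Or.inl h1
    · rintro (h2 | h2)
      · have h3 : accepted₁ a s = some ⟨i, hi⟩ := accepted₁_eq_some_iff.2 h2
        rw [h, Option.some.injEq] at h3
        simp [h3]
      · exact absurd h1.1 (h2.2 l l.2)

/-- The positions of the first `t` items of Phase 1 and the first `j` items of Phase 2. -/
def observed (n t j : ℕ) : Finset (Fin (n + n)) :=
  Finset.univ.filter fun x => x.val < t ∨ (n ≤ x.val ∧ x.val < n + j)

/-- The `m`-th position among all the positions of both phases. -/
def position (hn : 0 < n) (m : ℕ) : Fin (n + n) := ⟨min m (n + n - 1), by omega⟩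

theorem position_castAdd (hn : 0 < n) (i : Fin n) : position hn i = Fin.castAdd n i := by
  ext; simp only [position, Fin.val_castAdd]; omega

theorem position_natAdd (hn : 0 < n) (j : Fin n) : position hn (n + j) = Fin.natAdd n j := by
  ext; simp only [position, Fin.val_natAdd]; omega

theorem castAdd_mem_observed {t j : ℕ} {l : Fin n} (h : (l : ℕ) < t) :
    Fin.castAdd n l ∈ observed n t j := by
  simp [observed, h]

theorem natAdd_mem_observed {t j : ℕ} {l : Fin n} (h : (l : ℕ) < j) :
    Fin.natAdd n l ∈ observed n t j := by
  simp only [observed, Finset.mem_filter, Finset.mem_univ, true_and, Fin.val_natAdd]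
  omega

theorem position_notMem_observed₁ (hn : 0 < n) {i : ℕ} (hi : i < n) :
    position hn i ∉ observed n i 0 := by
  simp only [observed, position, Finset.mem_filter, Finset.mem_univ, true_and]
  omega

theorem observed_succ₁ (hn : 0 < n) {i : ℕ} (hi : i < n) :
    observed n (i + 1) 0 = insert (position hn i) (observed n i 0) := by
  ext x
  simp only [observed, position, Finset.mem_filter, Finset.mem_univ, true_and, Finset.mem_insert,
    Fin.ext_iff]
  omega

theorem position_notMem_observed₂ (hn : 0 < n) {t j : ℕ} (ht : t ≤ n) (hj : j < n) :
    position hn (n + j) ∉ observed n t j := by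
  simp only [observed, position, Finset.mem_filter, Finset.mem_univ, true_and]
  omega

theorem observed_succ₂ (hn : 0 < n) {t j : ℕ} (hj : j < n) :
    observed n t (j + 1) = insert (position hn (n + j)) (observed n t j) := by
  ext x
  simp only [observed, position, Finset.mem_filter, Finset.mem_univ, true_and, Finset.mem_insert,
    Fin.ext_iff]
  omega

theorem card_observed (hn : 0 < n) {t j : ℕ} (ht : t ≤ n) (hj : j ≤ n) :
    (observed n t j).card = t + j := by
  induction j with
  | zero =>
    induction t with
    | zero => simp [observed]
    | succ t ih =>
      rw [observed_succ₁ hn ht, Finset.card_insert_of_notMem (position_notMem_observed₁ hn ht),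
        ih (by omega)]
  | succ j ih =>
    rw [observed_succ₂ hn hj, Finset.card_insert_of_notMem (position_notMem_observed₂ hn ht hj),
      ih (by omega)]
    omega

section Congr

variable {a b : Equiv.Perm (Fin (n + n))} {t k : ℕ}

theorem val_lt_of_mem_take_finRange {i : Fin n} (h : i ∈ (List.finRange n).take k) :
    (i : ℕ) < k := by
  obtain ⟨l, hl, rfl⟩ := List.mem_take_iff_getElem.1 h
  simp only [List.getElem_finRange]
  exact lt_of_lt_of_le hl (min_le_left _ _)

theorem history₁_congr
    (hab : ∀ x ∈ observed n t k, ∀ y ∈ observed n t k, a x ≤ a y ↔ b x ≤ b y)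
    {i : ℕ} (hi : i ≤ t) : history₁ a i = history₁ b i := by
  refine List.map_congr_left fun l hl => ?_
  replace hl := val_lt_of_mem_take_finRange hl
  unfold relRank₁
  congr 1
  refine Finset.filter_congr fun m _ => and_congr_right fun hm => ?_
  have : (m : ℕ) ≤ l := hm
  exact hab _ (castAdd_mem_observed (by omega)) _ (castAdd_mem_observed (by omega))

theorem history₂_congr
    (hab : ∀ x ∈ observed n t k, ∀ y ∈ observed n t k, a x ≤ a y ↔ b x ≤ b y)
    {j : ℕ} (hj : j ≤ k) : history₂ a t j = history₂ b t j := by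
  refine List.map_congr_left fun l hl => ?_
  replace hl := val_lt_of_mem_take_finRange hl
  unfold relRank₂
  congr 2
  · refine Finset.filter_congr fun m _ => and_congr_right fun hm => ?_
    exact hab _ (castAdd_mem_observed hm) _ (natAdd_mem_observed (by omega))
  · refine Finset.filter_congr fun m _ => and_congr_right fun hm => ?_
    have : (m : ℕ) ≤ l := hm
    exact hab _ (natAdd_mem_observed (by omega)) _ (natAdd_mem_observed (by omega))

end Congr

theorem dependsOnOrder_accepts₁ (s : Strategy) (i : ℕ) :
    DependsOnOrder (observed n (i + 1) 0) (Accepts₁ s i) := fun a b hab h => by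
  rwa [Accepts₁, ← history₁_congr hab le_rfl]

theorem dependsOnOrder_accepts₂ (s : Strategy) (t j : ℕ) :
    DependsOnOrder (observed n t (j + 1)) (Accepts₂ s t j) := fun a b hab h => by
  rwa [Accepts₂, ← history₁_congr hab le_rfl, ← history₂_congr hab le_rfl]

theorem observed_mono₁ {t t' : ℕ} (h : t ≤ t') (j : ℕ) : observed n t j ⊆ observed n t' j := by
  intro x
  simp only [observed, Finset.mem_filter, Finset.mem_univ, true_and]
  omega

/-- This lets Phase 2 be analysed conditionally on the length of Phase 1: later arrivals are
independent of the event. -/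
theorem dependsOnOrder_revealed₁ (s : Strategy) {i : ℕ} (hi : i < n) :
    DependsOnOrder (observed n (i + 1) 0) fun a => revealed₁ a s = i + 1 := by
  simp only [revealed₁_eq_succ_iff hi]
  have hnot : ∀ k ≤ i + 1,
      DependsOnOrder (observed n (i + 1) 0) fun a => ∀ l < k, ¬ Accepts₁ s l a := fun k hk =>
    DependsOnOrder.forall fun l => DependsOnOrder.forall fun hl =>
      ((dependsOnOrder_accepts₁ s l).mono (observed_mono₁ (by omega) 0)).not
  refine ((dependsOnOrder_accepts₁ s i).and (hnot i (by omega))).or ?_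
  by_cases h : i + 1 = n
  · exact (DependsOnOrder.const _).and (hnot n h.ge)
  · exact fun a b _ hab => absurd hab.1 h

end Events

/-! ### Bounding the probability of accepting the best item -/

section Wins

variable {n : ℕ}

/-- The number of arrival orders for which the best item is accepted. -/
noncomputable def winCount (n : ℕ) (s : Strategy) : ℕ :=
  ∑ i : Fin n, count (fun a => accepted₁ a s = some i ∧ ∀ y, a (Fin.castAdd n i) ≤ a y) +
    ∑ j : Fin n, count (fun a => accepted₂ a s = some j ∧ ∀ y, a (Fin.natAdd n j) ≤ a y)

/-- What Phase 2 is worth (times `2n`) after `i + 1` items of Phase 1. -/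
noncomputable def secondValue (n i : ℕ) : ℝ := secretaryPotential (i + n) i

theorem secondPhase_bound (s : Strategy) {i : ℕ} (hi : i < n) :
    ((n + n : ℕ) : ℝ) * ∑ j : Fin n, (count fun a => revealed₁ a s = i + 1 ∧
      accepted₂ a s = some j ∧ ∀ y, a (Fin.natAdd n j) ≤ a y : ℕ) ≤
      secondValue n i * count fun a : Equiv.Perm (Fin (n + n)) => revealed₁ a s = i + 1 := by
  have hn : 0 < n := by omega
  have hL : (0 : ℝ) < i + n := by positivity
  have hstep := fun j : ℕ =>
    secretaryPotential_step hL (show (0 : ℝ) ≤ (i + j : ℕ) from Nat.cast_nonneg _)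
  have hcard : ∀ j < n, ((observed n (i + 1) j).card : ℝ) = i + 1 + j := fun j hj => by
    rw [card_observed hn hi hj.le]; push_cast; ring
  have h := stopping_bound n (observed n (i + 1)) (fun j => position hn (n + j))
    (fun j hj => position_notMem_observed₂ hn hi hj) (fun j hj => observed_succ₂ hn hj)
    (fun a => revealed₁ a s = i + 1) (Accepts₂ s (i + 1)) (dependsOnOrder_revealed₁ s hi)
    (fun j _ => dependsOnOrder_accepts₂ s _ j) (fun _ => 0)
    (fun j => secretaryPotential (i + n) (i + j : ℕ))
    (fun j hj => secretaryPotential_nonneg hL <| by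
      have : i + (j + 1) ≤ i + n := by omega
      exact_mod_cast this)
    (fun j hj => by
      have := (hstep j).2
      rw [← add_assoc]; push_cast at this ⊢; exact this)
    (fun j hj => by
      have := (hstep j).1
      rw [hcard j hj, ← add_assoc]; push_cast at this ⊢
      convert this using 2 <;> ring)
  simp only [zero_mul, add_zero] at h
  refine le_trans ?_ h
  rw [← Finset.mul_sum, Finset.sum_range]
  -- The terminal term is dropped: an observer who accepts nothing in Phase 2 gets nothing.
  refine le_add_of_le_of_nonneg (le_of_eq ?_) (mul_nonneg (secretaryPotential_nonneg hL
    (by push_cast; rfl)) (Nat.cast_nonneg _))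
  push_cast
  refine congrArg _ (Finset.sum_congr rfl fun j _ => congrArg _ (count_congr fun a => ?_))
  rw [position_natAdd, and_assoc]
  refine and_congr_right fun h => and_congr_left fun _ => ?_
  rw [accepted₂_eq_some_iff, h]

theorem count_eq_sum_revealed₁ (hn : 0 < n) (s : Strategy)
    (E : Equiv.Perm (Fin (n + n)) → Prop) :
    count E = ∑ i ∈ Finset.range n, count fun a => revealed₁ a s = i + 1 ∧ E a := by
  classical
  have h := Finset.card_eq_sum_card_fiberwise (s := Finset.univ.filter E)
    (f := fun a => revealed₁ a s - 1) (t := Finset.range n) fun a _ => by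
      have := revealed₁_le a s
      simp only [Finset.coe_range, Set.mem_Iio]
      omega
  rw [count_eq_card_filter, h]
  refine Finset.sum_congr rfl fun i _ => ?_
  rw [count_eq_card_filter, Finset.filter_filter]
  congr 1
  refine Finset.filter_congr fun a _ => ?_
  have := revealed₁_pos hn a s
  rw [and_comm]
  refine and_congr_left fun _ => ?_
  omega

/-- All n items are revealed both when the last one is accepted and when none is; only the first
case is a stop in Phase 1. -/
theorem count_revealed₁ (s : Strategy) {i : ℕ} (hi : i < n) :
    count (fun a : Equiv.Perm (Fin (n + n)) => revealed₁ a s = i + 1) =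
      count (fun a : Equiv.Perm (Fin (n + n)) => FirstAt (Accepts₁ s) i a) +
      if i + 1 = n then count (fun a : Equiv.Perm (Fin (n + n)) => ∀ l < n, ¬ Accepts₁ s l a)
      else 0 := by
  rw [← count_and_add_count_and_not _ fun a => Accepts₁ s i a]
  congr 1
  · refine count_congr fun a => ?_
    rw [revealed₁_eq_succ_iff hi]
    constructor
    · rintro ⟨h1 | h1, h2⟩
      exacts [h1, absurd h2 (h1.2 i hi)]
    · exact fun h => ⟨Or.inl h, h.1⟩
  · split_ifs with h
    · refine count_congr fun a => ?_
      rw [revealed₁_eq_succ_iff hi]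
      constructor
      · rintro ⟨h1 | h1, h2⟩
        exacts [absurd h1.1 h2, h1.2]
      · exact fun h1 => ⟨Or.inr ⟨h, h1⟩, h1 i hi⟩
    · rw [count, Nat.card_eq_zero]
      refine Or.inl ⟨fun a => ?_⟩
      obtain ⟨h1, h2⟩ := a.2
      rw [revealed₁_eq_succ_iff hi] at h1
      rcases h1 with h1 | h1
      exacts [h2 h1.1, h h1.1]

theorem winCount_le (j n : ℕ) (hj : 1000 ≤ j) (hn : n = 1000 * j + 1) (s : Strategy) :
    (winCount n s : ℝ) ≤ 0.502 * Fintype.card (Equiv.Perm (Fin (n + n))) := by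
  have hn0 : 0 < n := by omega
  have hn0' : (0 : ℝ) < n := by exact_mod_cast hn0
  obtain ⟨h, h0, hv, hanti, hstep⟩ := exists_firstPotential j n hj hn (secondValue n)
    (fun i _ => secretaryPotential_le (by positivity))
    (fun i _ => secretaryPotential_le_of_le (by positivity))
  have hb := stopping_bound n (fun i => observed n i 0) (fun i => position hn0 i)
    (fun i hi => position_notMem_observed₁ hn0 hi) (fun i hi => observed_succ₁ hn0 hi)
    (fun _ => True) (Accepts₁ s) (DependsOnOrder.const _)
    (fun i _ => dependsOnOrder_accepts₁ s i) (secondValue n) h hv hanti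
    (fun i hi => by
      rw [card_observed hn0 hi.le (Nat.zero_le _)]
      exact_mod_cast hstep i hi)
  simp only [true_and] at hb
  have hall : count (fun _ : Equiv.Perm (Fin (n + n)) => True) =
      Fintype.card (Equiv.Perm (Fin (n + n))) := by
    classical
    rw [count_eq_card_filter]; simp
  rw [hall, h0, Finset.sum_add_distrib, ← Finset.mul_sum] at hb
  have hsecond : ((n + n : ℕ) : ℝ) * ∑ j : Fin n, (count fun a =>
      accepted₂ a s = some j ∧ ∀ y, a (Fin.natAdd n j) ≤ a y : ℕ) ≤
      ∑ i ∈ Finset.range n, secondValue n i *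
        count (fun a : Equiv.Perm (Fin (n + n)) => FirstAt (Accepts₁ s) i a) +
      h n * count fun a : Equiv.Perm (Fin (n + n)) => ∀ l < n, ¬ Accepts₁ s l a := by
    have h1 := Finset.sum_le_sum (s := Finset.range n) fun i hi =>
      secondPhase_bound s (Finset.mem_range.1 hi)
    -- Orders without acceptance in Phase 1 still reach Phase 2 with n observed items; the terminal
    -- term of `stopping_bound` pays for them.
    have h2 : secondValue n (n - 1) ≤ h n := by
      have := hv (n - 1) (by omega)
      rwa [Nat.sub_add_cancel hn0] at this
    rw [← Finset.mul_sum] at h1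
    push_cast at h1 ⊢
    rw [Finset.sum_comm] at h1
    simp only [count_eq_sum_revealed₁ hn0 s (fun a => accepted₂ a s = some _ ∧ _), Nat.cast_sum]
    refine h1.trans ?_
    have h3 : ∀ i ∈ Finset.range n, secondValue n i *
        (count (fun a : Equiv.Perm (Fin (n + n)) => revealed₁ a s = i + 1) : ℝ) =
        secondValue n i * count (fun a : Equiv.Perm (Fin (n + n)) => FirstAt (Accepts₁ s) i a) +
        if i = n - 1 then secondValue n (n - 1) *
          count (fun a : Equiv.Perm (Fin (n + n)) => ∀ l < n, ¬ Accepts₁ s l a) else 0 := by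
      intro i hi
      rw [Finset.mem_range] at hi
      rw [count_revealed₁ s hi]
      by_cases hin : i = n - 1
      · rw [if_pos hin, if_pos (by omega), ← hin]; push_cast; ring
      · rw [if_neg hin, if_neg (by omega)]; push_cast; ring
    rw [Finset.sum_congr rfl h3, Finset.sum_add_distrib, Finset.sum_ite_eq',
      if_pos (Finset.mem_range.2 (by omega))]
    have := mul_le_mul_of_nonneg_right h2 (Nat.cast_nonneg (α := ℝ)
      (count fun a : Equiv.Perm (Fin (n + n)) => ∀ l < n, ¬ Accepts₁ s l a))
    linarith
  have hfirst : ∑ i ∈ Finset.range n, (count (fun a : Equiv.Perm (Fin (n + n)) =>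
      FirstAt (Accepts₁ s) i a ∧ ∀ y, a (position hn0 i) ≤ a y) : ℝ) =
      ∑ i : Fin n, (count fun a => accepted₁ a s = some i ∧
        ∀ y, a (Fin.castAdd n i) ≤ a y : ℕ) := by
    rw [Finset.sum_range]
    push_cast
    refine Finset.sum_congr rfl fun i _ => congrArg _ (count_congr fun a => ?_)
    rw [position_castAdd, accepted₁_eq_some_iff]
  rw [hfirst] at hb
  have hmain : ((n + n : ℕ) : ℝ) * winCount n s ≤
      1.004 * n * Fintype.card (Equiv.Perm (Fin (n + n))) := by
    rw [winCount]
    push_cast at hb hsecond ⊢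
    rw [mul_add]
    linarith
  refine le_of_mul_le_mul_left (hmain.trans (le_of_eq ?_)) (show (0 : ℝ) < (n + n : ℕ) by positivity)
  push_cast
  ring

end Wins

/-! ### The instance with a single positive value -/

section SinglePositive

variable {n : ℕ}

/-- The instance in which the best item has value `1` and all the others have value `0`. -/
def singlePositive (hn : 0 < n) : Instance n where
  val i := if i.val = 0 then 1 else 0
  antitone_val i j hij := by
    have : i.val ≤ j.val := hij
    dsimp only
    split_ifs <;> first | omega | norm_num
  nonneg i := by split_ifs <;> norm_num
  exists_pos := ⟨⟨0, by omega⟩, by simp⟩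

variable (tie : TieBreaking) (hn : 0 < n)

open scoped Classical in
-- Every consistent tie-breaking rule puts the positive item first, so its value is visible in the
-- ranking alone.
theorem singlePositive_val (x : Fin (n + n)) :
    (singlePositive hn).val x = if ∀ y, tie.place n (singlePositive hn) x ≤
      tie.place n (singlePositive hn) y then 1 else 0 := by
  have h0 : ∀ y : Fin (n + n), y.val ≠ 0 → tie.place n (singlePositive hn) ⟨0, by omega⟩ <
      tie.place n (singlePositive hn) y := fun y hy =>
    tie.consistent n _ _ _ (by simp [singlePositive, hy])
  by_cases hx : x.val = 0
  · have hx0 : x = ⟨0, by omega⟩ := Fin.ext hx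
    rw [hx0, if_pos]
    · simp [singlePositive]
    · intro y
      by_cases hy : y.val = 0
      · exact (congrArg _ (Fin.ext hy.symm)).le
      · exact (h0 y hy).le
  · rw [if_neg fun h => (h0 x hx).not_ge (h _)]
    simp [singlePositive, hx]

theorem option_elim_eq_sum {ι : Type*} [Fintype ι] [DecidableEq ι] (o : Option ι) (f : ι → ℝ) :
    o.elim 0 f = ∑ i, if o = some i then f i else 0 := by
  cases o <;> simp

theorem expect_payoff_singlePositive (s : Strategy) :
    expect (payoff tie (singlePositive hn) s) =
      winCount n s / Fintype.card (Equiv.Perm (Fin (n + n))) := by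
  classical
  have hcount : ∀ E : Equiv.Perm (Fin (n + n)) → Prop,
      (count E : ℝ) = ∑ a, if E a then 1 else 0 := fun E => by
    rw [count_eq_card_filter]; simp
  -- Composing with a fixed ranking preserves the uniform distribution, so the sum may run over the
  -- orders of places instead of items.
  set π := tie.place n (singlePositive hn) with hπ
  have hinv : ∀ f : Equiv.Perm (Fin (n + n)) → ℝ, ∑ σ, f (Equiv.trans σ π) = ∑ a, f a := fun f =>
    Equiv.sum_comp (Equiv.equivCongr (Equiv.refl _) π) f
  rw [expect]
  congr 1
  rw [winCount]
  push_cast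
  simp only [hcount]
  rw [Finset.sum_comm, Finset.sum_comm (t := (Finset.univ : Finset (Equiv.Perm (Fin (n + n)))))
    (s := (Finset.univ : Finset (Fin n))), ← Finset.sum_add_distrib]
  refine Eq.trans (Finset.sum_congr rfl fun σ _ => ?_) (hinv _)
  rw [payoff, option_elim_eq_sum, option_elim_eq_sum]
  have hall : ∀ x : Fin (n + n), (∀ y, (σ.trans π) x ≤ (σ.trans π) y) ↔ ∀ y, π (σ x) ≤ π y :=
    fun x => ⟨fun h y => by simpa using h (σ.symm y), fun h y => h _⟩
  simp only [singlePositive_val tie hn, hall, ← hπ, ite_and]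

theorem one_le_prophet (σ : Equiv.Perm (Fin (n + n))) :
    1 ≤ prophet (singlePositive hn) σ := by
  set v := singlePositive hn
  have hbdd : ∀ f : Fin n → Fin (n + n), BddAbove (Set.range fun i => v.val (f i)) :=
    fun f => Set.finite_range _ |>.bddAbove
  have hnn : ∀ f : Fin n → Fin (n + n), 0 ≤ ⨆ i, v.val (f i) :=
    fun f => Real.iSup_nonneg fun i => v.nonneg _
  obtain ⟨x, hx⟩ := σ.surjective ⟨0, by omega⟩
  have hval : v.val (σ x) = 1 := by rw [hx]; simp [v, singlePositive]
  unfold prophet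
  induction x using Fin.addCases with
  | left i =>
    have := le_ciSup (hbdd fun i => σ (Fin.castAdd n i)) i
    have := hnn fun j => σ (Fin.natAdd n j)
    simp only [hval] at *
    linarith
  | right j =>
    have := le_ciSup (hbdd fun j => σ (Fin.natAdd n j)) j
    have := hnn fun i => σ (Fin.castAdd n i)
    simp only [hval] at *
    linarith

theorem one_le_expect_prophet : 1 ≤ expect (prophet (singlePositive hn)) := by
  rw [expect, one_le_div (by exact_mod_cast Fintype.card_pos)]
  calc (Fintype.card (Equiv.Perm (Fin (n + n))) : ℝ) =
      ∑ _σ : Equiv.Perm (Fin (n + n)), (1 : ℝ) := by simp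
    _ ≤ _ := Finset.sum_le_sum fun σ _ => one_le_prophet hn σ

theorem tsum_toReal_mul_le {α : Type*} (p : PMF α) (f : α → ℝ) (c : ℝ) (h0 : ∀ x, 0 ≤ f x)
    (hc : ∀ x, f x ≤ c) : ∑' x, (p x).toReal * f x ≤ c := by
  have hp : HasSum (fun x => (p x).toReal) 1 := by
    have := ENNReal.hasSum_toReal (f := p) (by rw [p.tsum_coe]; exact ENNReal.one_ne_top)
    rwa [← ENNReal.tsum_toReal_eq p.apply_ne_top, p.tsum_coe, ENNReal.toReal_one] at this
  have hle : ∀ x, (p x).toReal * f x ≤ (p x).toReal * c := fun x =>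
    mul_le_mul_of_nonneg_left (hc x) ENNReal.toReal_nonneg
  have hs := hp.mul_right c
  have h := Summable.of_nonneg_of_le
    (fun x => mul_nonneg ENNReal.toReal_nonneg (h0 x)) hle hs.summable
  simpa using (h.tsum_le_tsum hle hs.summable).trans hs.tsum_eq.le

end SinglePositive

theorem limitPerformance_le (tie : TieBreaking) (A : Algorithm) :
    limitPerformance tie A ≤ ((0.502 : ℝ) : EReal) := by
  refine Filter.liminf_le_of_frequently_le' (Filter.frequently_atTop.2 fun m => ?_)
  -- For the limit inferior arbitrarily large n suffice; this form makes the breakpoints of the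
  -- potential integers.
  obtain ⟨n, hn⟩ : ∃ n, n = 1000 * (m + 1000) + 1 := ⟨_, rfl⟩
  refine ⟨n, by omega, ?_⟩
  have hn0 : 0 < n := by omega
  refine iInf_le_of_le (singlePositive hn0) (EReal.coe_le_coe_iff.2 ?_)
  have hcard : (0 : ℝ) < Fintype.card (Equiv.Perm (Fin (n + n))) := by
    exact_mod_cast Fintype.card_pos
  have hnum : expectedValue tie A (singlePositive hn0) ≤ 0.502 := by
    refine tsum_toReal_mul_le _ _ _ (fun s => ?_) fun s => ?_
    · rw [expect_payoff_singlePositive]; positivity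
    · rw [expect_payoff_singlePositive, div_le_iff₀ hcard]
      exact winCount_le (m + 1000) n (by omega) hn s
  have hden := one_le_expect_prophet hn0
  rw [div_le_iff₀ (by linarith)]
  linarith

end RepeatedProphet

theorem mainTheorem1 (tie : RepeatedProphet.TieBreaking) :
    (∀ A : RepeatedProphet.Algorithm,
      RepeatedProphet.limitPerformance tie A ≤ ((0.502 : ℝ) : EReal)) ∧
    (∀ A : RepeatedProphet.ObliviousAlgorithm,
      RepeatedProphet.limitPerformance tie A.toAlgorithm ≤ ((0.502 : ℝ) : EReal)) :=
  ⟨RepeatedProphet.limitPerformance_le tie,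
    fun A => RepeatedProphet.limitPerformance_le tie A.toAlgorithm⟩
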